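/- Fix a relational vocabulary consisting of countably infinitely many unary and countably infinitely many binary relation symbols. A model is a nonempty set together with an interpretation of every symbol. An abstract logic is a pair $\mathcal{L}=(\mathsf{Fml}_{\mathcal{L}},\models_{\mathcal{L}})$ of a collection of sentences and a truth relation between models and sentences such that truth of $\mathcal{L}$-sentences is preserved under isomorphisms and $\mathcal{L}$ has the following closure properties: - (Boolean connectives) for every $\varphi\in\mathcal{L}$ there is $\psi\in\mathcal{L}$ such that for all models $M$, $M\models\psi$ iff $M\not\models\varphi$; and for all $\varphi,\psi\in\mathcal{L}$ there is $\chi\in\mathcal{L}$ such that for all models $M$, $M\models\chi$ iff $M\models\varphi$ and $M\models\psi$; - (renamings) for every map $\rho$ sending relation symbols to relation symbols of the same arity and every $\varphi\in\mathcal{L}$ there is $\psi\in\mathcal{L}$ such that for all models $M$, $M\models\psi$ iff $\rho(M)\models\varphi$, where $\rho(M)$ has the domain of $M$ and interprets each symbol $R$ as $\rho(R)^M$; - (relativisation) for every $\varphi\in\mathcal{L}$ and every unary symbol $P$ there is $\psi\in\mathcal{L}$ such that for all models $M$ with $P^M\neq\emptyset$, $M\models\psi$ iff $M^P\models\varphi$,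 where $M^P$ is the submodel of $M$ induced by $P^M$. For pairs $\mathcal{L},\mathcal{L}'$ of sentences and truth relation, $\mathcal{L}$ is contained in $\mathcal{L}'$ (and $\mathcal{L}'$ extends $\mathcal{L}$) if there is a map $f:\mathsf{Fml}_{\mathcal{L}}\to\mathsf{Fml}_{\mathcal{L}'}$ such that for all models $M$ and $\varphi\in\mathcal{L}$, $M\models_{\mathcal{L}}\varphi$ iff $M\models_{\mathcal{L}'}f(\varphi)$. $\mathcal{L}$ has Compactness if every set of $\mathcal{L}$-sentences all of whose finite subsets have a model has itself a model. A potential isomorphism between models $M$ and $N$ is a nonempty family $F$ of partial isomorphisms between $M$ and $N$ such that for every $f\in F$ and every $a\in M$ there is $g\in F$ extending $f$ with $a\in\mathrm{dom}(g)$, and for every $f\in F$ and every $b\in N$ there is $g\in F$ extending $f$ with $b\in\mathrm{ran}(g)$. $\mathcal{L}$ is invariant for potential isomorphisms if any two models between which there is a potential isomorphism satisfy the same $\mathcal{L}$-sentences. $FO$ is first-order logic with equality over this vocabulary, and $FO^3$ is its three-variable fragment: the sentences in which at most three variables, free or bound, occur, where variables may be requantified. **Theorem.** Let $\mathcal{L}$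 be an abstract logic extending $FO^3$. Then $\mathcal{L}$ is contained in $FO$ if and only if $\mathcal{L}$ has Compactness and is invariant for potential isomorphisms. -/

import Mathlib

open scoped FirstOrder

universe u v w

namespace Lindstrom

/-- The relation symbols: countably infinitely many unary and countably infinitely many binary
ones. -/
inductive SigRel : ℕ → Type
  | unary (i : ℕ) : SigRel 1
  | binary (i : ℕ) : SigRel 2

/-- The fixed vocabulary, without function and constant symbols. -/
def Sig : FirstOrder.Language.{0, 0} where
  Functions _ := Empty
  Relations := SigRel

instance : Sig.IsRelational := fun _ => inferInstanceAs (IsEmpty Empty)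

/-- A model: a nonempty set with an interpretation of every relation symbol. -/
structure Model : Type (u + 1) where
  carrier : Type u
  [str : Sig.Structure carrier]
  [nonempty : Nonempty carrier]

attribute [instance] Model.str Model.nonempty

namespace Model

/-- `M.Holds P x`: the element `x` satisfies the unary relation symbol `P`. -/
def Holds (M : Model.{u}) (P : Sig.Relations 1) (x : M.carrier) : Prop :=
  FirstOrder.Language.Structure.RelMap P ![x]

/-- The substructure of `M` whose domain is the subset defined by the unary symbol `P`. -/
def definedBy (M : Model.{u}) (P : Sig.Relations 1) : Sig.Substructure M.carrier where
  carrier := {x | M.Holds P x}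
  fun_mem := fun f => isEmptyElim f

/-- The relativisation `M^P`: the submodel of `M` induced by the (nonempty) subset defined
by `P`. -/
def relativise (M : Model.{u}) (P : Sig.Relations 1) (h : ∃ x, M.Holds P x) : Model.{u} where
  carrier := M.definedBy P
  nonempty := h.elim fun x hx => ⟨⟨x, hx⟩⟩

/-- The renaming `ρ(M)` of `M` along an arity preserving map `ρ` of relation symbols to relation
symbols: it has the domain of `M`, and interprets a symbol `R` as `M` interprets `ρ(R)`. -/
def rename (M : Model.{u}) (ρ : Sig →ᴸ Sig) : Model.{u} where
  carrier := M.carrier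
  str := ρ.reduct M.carrier

/-- `M` and `N` are potentially isomorphic: there is a nonempty family of partial isomorphisms
between them with the back-and-forth properties. (As there are no function symbols, partial
isomorphisms in the sense of Mathlib have arbitrary subsets as their domains.) -/
def PotentiallyIsomorphic (M N : Model.{u}) : Prop :=
  ∃ F : Set (M.carrier ≃ₚ[Sig] N.carrier), F.Nonempty ∧
    (∀ f ∈ F, ∀ a : M.carrier, ∃ g ∈ F, f ≤ g ∧ a ∈ g.dom) ∧
    (∀ f ∈ F, ∀ b : N.carrier, ∃ g ∈ F, f ≤ g ∧ b ∈ g.cod)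

end Model

/-- A pair consisting of a collection of sentences and a truth relation between models and
sentences. -/
structure Logic : Type (max (u + 1) (v + 1)) where
  Fml : Type v
  Sat : Model.{u} → Fml → Prop

namespace Logic

/-- The requirements that make a pair `(Fml, Sat)` an abstract logic. -/
structure IsAbstractLogic (𝓛 : Logic.{u, v}) : Prop where
  iso_invariant : ∀ M N : Model.{u}, Nonempty (M.carrier ≃[Sig] N.carrier) →
    ∀ φ, 𝓛.Sat M φ ↔ 𝓛.Sat N φ
  neg : ∀ φ, ∃ ψ, ∀ M, 𝓛.Sat M ψ ↔ ¬ 𝓛.Sat M φ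
  conj : ∀ φ ψ, ∃ χ, ∀ M, 𝓛.Sat M χ ↔ (𝓛.Sat M φ ∧ 𝓛.Sat M ψ)
  rename : ∀ (ρ : Sig →ᴸ Sig) (φ), ∃ ψ, ∀ M, 𝓛.Sat M ψ ↔ 𝓛.Sat (M.rename ρ) φ
  relativise : ∀ (P : Sig.Relations 1) (φ), ∃ ψ, ∀ (M : Model.{u}) (h : ∃ x, M.Holds P x),
    𝓛.Sat M ψ ↔ 𝓛.Sat (M.relativise P h) φ

/-- `𝓛` is contained in `𝓛'` (equivalently, `𝓛'` extends `𝓛`): there is a truth preserving map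
from the sentences of `𝓛` to those of `𝓛'`. -/
def ContainedIn (𝓛 : Logic.{u, v}) (𝓛' : Logic.{u, w}) : Prop :=
  ∃ f : 𝓛.Fml → 𝓛'.Fml, ∀ (M : Model.{u}) (φ : 𝓛.Fml), 𝓛.Sat M φ ↔ 𝓛'.Sat M (f φ)

/-- A set of sentences is satisfiable if all its members are true in a common model. -/
def Satisfiable (𝓛 : Logic.{u, v}) (S : Set 𝓛.Fml) : Prop :=
  ∃ M : Model.{u}, ∀ φ ∈ S, 𝓛.Sat M φ

/-- Compactness. -/
def HasCompactness (𝓛 : Logic.{u, v}) : Prop :=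
  ∀ S : Set 𝓛.Fml, (∀ T ⊆ S, T.Finite → 𝓛.Satisfiable T) → 𝓛.Satisfiable S

/-- Invariance for potential isomorphisms (the Karp property). -/
def InvariantForPotentialIsomorphisms (𝓛 : Logic.{u, v}) : Prop :=
  ∀ M N : Model.{u}, M.PotentiallyIsomorphic N → ∀ φ, 𝓛.Sat M φ ↔ 𝓛.Sat N φ

end Logic

/-- First-order logic (with equality) over the fixed vocabulary. -/
def FO : Logic.{u, 0} where
  Fml := Sig.Sentence
  Sat M φ := M.carrier ⊨ φ

/-- First-order formulas (with equality) in which only the `k` variables `x_0, …, x_{k-1}` occur,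
free or bound; a variable may be quantified repeatedly. The other connectives and the existential
quantifier are definable from these. -/
inductive VarFormula (k : ℕ) : Type
  | falsum : VarFormula k
  | eq (i j : Fin k) : VarFormula k
  | rel {n : ℕ} (R : Sig.Relations n) (xs : Fin n → Fin k) : VarFormula k
  | imp (φ ψ : VarFormula k) : VarFormula k
  | all (i : Fin k) (φ : VarFormula k) : VarFormula k

namespace VarFormula

/-- Satisfaction of a formula in a model under an assignment of the variables. -/
def Realize (M : Model.{u}) {k : ℕ} : VarFormula k → (Fin k → M.carrier) → Prop
  | falsum, _ => False
  | eq i j, s => s i = s j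
  | rel R xs, s => FirstOrder.Language.Structure.RelMap R (fun m => s (xs m))
  | imp φ ψ, s => φ.Realize M s → ψ.Realize M s
  | all i φ, s => ∀ a : M.carrier, φ.Realize M (Function.update s i a)

/-- The variables that occur free in a formula. -/
def freeVars {k : ℕ} : VarFormula k → Set (Fin k)
  | falsum => ∅
  | eq i j => {i, j}
  | rel _ xs => Set.range xs
  | imp φ ψ => φ.freeVars ∪ ψ.freeVars
  | all i φ => φ.freeVars \ {i}

end VarFormula

/-- The `k`-variable fragment of first-order logic: its sentences are the formulas in `k` variables
without free variables. Their truth in a model does not depend on the assignment. -/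
def FOVar (k : ℕ) : Logic.{u, 0} where
  Fml := {φ : VarFormula k // φ.freeVars = ∅}
  Sat M φ := ∀ s : Fin k → M.carrier, φ.1.Realize M s

end Lindstrom

/-! First-order logic is compact (`FO_hasCompactness`) and invariant (`FO_invariant`), and both
properties pass to contained logics. The converse is `definable_FO`.

By compactness, a sentence `φ` of `𝓛` depends only on the symbols of index below some `k`
(`exists_dependsOn`). Over finitely many symbols, finitely many first-order formulas control the
`n`-round Ehrenfeucht–Fraïssé game, so a class closed under `n`-round equivalence is first-order
definable (`definable_FO_of_ef`). Hence if `φ` is not first-order definable, for each `n` there are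
`n`-round equivalent `M ⊨ φ` and `N ⊭ φ`.

Such a pair, with its game, is coded in one model. The pairs of elements and the positions are
themselves elements, so a position of any length is described by one binary membership relation, and
three requantified variables suffice for the rules. Compactness gives a coded game whose initial
position has no finite number of rounds left. The positions with no finite level form a
back-and-forth system between the boards (`IsGame.potentiallyIsomorphic`), yet `φ` holds on only one
of them, contradicting invariance. -/

namespace Lindstrom

open FirstOrder FirstOrder.Language

/-! ### Models, partial isomorphisms and back-and-forth systems -/

namespace Model

/-- The interpretation of the `i`-th unary symbol. -/
def un (M : Model.{u}) (i : ℕ) (x : M.carrier) : Prop :=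
  Structure.RelMap (L := Sig) (SigRel.unary i : Sig.Relations 1) ![x]

/-- The interpretation of the `i`-th binary symbol. -/
def bin (M : Model.{u}) (i : ℕ) (x y : M.carrier) : Prop :=
  Structure.RelMap (L := Sig) (SigRel.binary i : Sig.Relations 2) ![x, y]

theorem relMap_unary (M : Model.{u}) (i : ℕ) (xs : Fin 1 → M.carrier) :
    Structure.RelMap (L := Sig) (SigRel.unary i : Sig.Relations 1) xs ↔ M.un i (xs 0) := by
  unfold un
  rw [show xs = ![xs 0] by ext j; fin_cases j; rfl]
  rfl

theorem relMap_binary (M : Model.{u}) (i : ℕ) (xs : Fin 2 → M.carrier) :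
    Structure.RelMap (L := Sig) (SigRel.binary i : Sig.Relations 2) xs ↔
      M.bin i (xs 0) (xs 1) := by
  unfold bin
  rw [show xs = ![xs 0, xs 1] by ext j; fin_cases j <;> rfl]
  rfl

/-- The model with prescribed interpretations of the symbols. -/
def mk' (X : Type u) [Nonempty X] (U : ℕ → X → Prop) (B : ℕ → X → X → Prop) : Model.{u} where
  carrier := X
  str :=
    { funMap := fun f => isEmptyElim f
      RelMap := fun {_} R => match R with
        | SigRel.unary i => fun xs => U i (xs 0)
        | SigRel.binary i => fun xs => B i (xs 0) (xs 1) }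

theorem un_mk' (X : Type u) [Nonempty X] (U : ℕ → X → Prop) (B : ℕ → X → X → Prop) (i : ℕ) (x : X) :
    (mk' X U B).un i x ↔ U i x := Iff.rfl

theorem bin_mk' (X : Type u) [Nonempty X] (U : ℕ → X → Prop) (B : ℕ → X → X → Prop) (i : ℕ)
    (x y : X) : (mk' X U B).bin i x y ↔ B i x y := Iff.rfl

/-- Two models are isomorphic as soon as a bijection preserves the unary and binary relations. -/
theorem nonempty_equiv (M N : Model.{u}) (e : M.carrier ≃ N.carrier)
    (hU : ∀ i x, N.un i (e x) ↔ M.un i x) (hB : ∀ i x y, N.bin i (e x) (e y) ↔ M.bin i x y) :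
    Nonempty (M.carrier ≃[Sig] N.carrier) := by
  refine ⟨⟨e, fun f => isEmptyElim f, ?_⟩⟩
  intro n R xs
  cases R with
  | unary i => exact (relMap_unary N i _).trans ((hU i (xs 0)).trans (relMap_unary M i xs).symm)
  | binary i =>
    exact (relMap_binary N i _).trans ((hB i (xs 0) (xs 1)).trans (relMap_binary M i xs).symm)

/-- The graph of a partial isomorphism. -/
def graph {M N : Model.{u}} (f : M.carrier ≃ₚ[Sig] N.carrier) (a : M.carrier) (b : N.carrier) :
    Prop :=
  ∃ h : a ∈ f.dom, (f.toEquiv ⟨a, h⟩ : N.carrier) = b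

theorem graph_mono {M N : Model.{u}} {f g : M.carrier ≃ₚ[Sig] N.carrier} (hfg : f ≤ g)
    {a : M.carrier} {b : N.carrier} (h : graph f a b) : graph g a b := by
  obtain ⟨h, rfl⟩ := h
  refine ⟨PartialEquiv.dom_le_dom hfg h, ?_⟩
  have := PartialEquiv.toEquiv_inclusion_apply hfg ⟨a, h⟩
  exact congrArg Subtype.val this

theorem graph_of_mem_cod {M N : Model.{u}} {f : M.carrier ≃ₚ[Sig] N.carrier} {b : N.carrier}
    (h : b ∈ f.cod) : ∃ a, graph f a b :=
  ⟨f.toEquiv.symm ⟨b, h⟩, (f.toEquiv.symm ⟨b, h⟩).2, by simp⟩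

theorem graph_relMap {M N : Model.{u}} {f : M.carrier ≃ₚ[Sig] N.carrier} {n : ℕ}
    (R : Sig.Relations n) {xs : Fin n → M.carrier} {ys : Fin n → N.carrier}
    (h : ∀ i, graph f (xs i) (ys i)) : Structure.RelMap R xs ↔ Structure.RelMap R ys := by
  choose h1 h2 using h
  have := f.toEquiv.map_rel R (fun i => ⟨xs i, h1 i⟩)
  have e : ys = fun i => ((f.toEquiv ⟨xs i, h1 i⟩ : f.cod) : N.carrier) := funext fun i => (h2 i).symm
  rw [e]
  exact this.symm

theorem graph_eq_iff {M N : Model.{u}} {f : M.carrier ≃ₚ[Sig] N.carrier}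
    {a a' : M.carrier} {b b' : N.carrier} (h : graph f a b) (h' : graph f a' b') :
    a = a' ↔ b = b' := by
  obtain ⟨h, rfl⟩ := h
  obtain ⟨h', rfl⟩ := h'
  rw [← Subtype.ext_iff, f.toEquiv.injective.eq_iff, Subtype.mk.injEq]

/-- First-order formulas are preserved by the members of a back-and-forth system. -/
theorem realize_iff_of_backAndForth {M N : Model.{u}} {F : Set (M.carrier ≃ₚ[Sig] N.carrier)}
    (forth : ∀ f ∈ F, ∀ a : M.carrier, ∃ g ∈ F, f ≤ g ∧ a ∈ g.dom)
    (back : ∀ f ∈ F, ∀ b : N.carrier, ∃ g ∈ F, f ≤ g ∧ b ∈ g.cod)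
    {n : ℕ} (φ : Sig.BoundedFormula Empty n) :
    ∀ f ∈ F, ∀ (xs : Fin n → M.carrier) (ys : Fin n → N.carrier),
      (∀ i, graph f (xs i) (ys i)) → (φ.Realize default xs ↔ φ.Realize default ys) := by
  have hterm : ∀ {n : ℕ} (t : Sig.Term (Empty ⊕ Fin n)), ∃ i : Fin n, t = Term.var (Sum.inr i) := by
    rintro n (⟨i | i⟩ | ⟨f, _⟩)
    · exact i.elim
    · exact ⟨i, rfl⟩
    · exact isEmptyElim f
  induction φ with
  | falsum => intros; rfl
  | equal t₁ t₂ =>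
    intro f _ xs ys h
    obtain ⟨i, rfl⟩ := hterm t₁
    obtain ⟨j, rfl⟩ := hterm t₂
    simpa [BoundedFormula.Realize] using graph_eq_iff (h i) (h j)
  | rel R ts =>
    intro f _ xs ys h
    refine graph_relMap R (f := f) fun i => ?_
    obtain ⟨j, hj⟩ := hterm (ts i)
    simpa [hj] using h j
  | imp φ ψ ih₁ ih₂ =>
    intro f hf xs ys h
    simp only [BoundedFormula.realize_imp, ih₁ f hf xs ys h, ih₂ f hf xs ys h]
  | @all n φ ih =>
    intro f hf xs ys h
    have key : ∀ g ∈ F, f ≤ g → ∀ a b, graph g a b →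
        (φ.Realize default (Fin.snoc xs a : Fin (n + 1) → M.carrier) ↔
          φ.Realize default (Fin.snoc ys b : Fin (n + 1) → N.carrier)) := by
      intro g hg hfg a b hab
      refine ih g hg _ _ fun i => ?_
      refine Fin.lastCases ?_ (fun i => ?_) i
      · simpa using hab
      · simpa using graph_mono hfg (h i)
    simp only [BoundedFormula.realize_all]
    constructor
    · intro H b
      obtain ⟨g, hg, hfg, hb⟩ := back f hf b
      obtain ⟨a, ha⟩ := graph_of_mem_cod hb
      exact (key g hg hfg a b ha).1 (H a)
    · intro H a
      obtain ⟨g, hg, hfg, ha⟩ := forth f hf a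
      exact (key g hg hfg a _ ⟨ha, rfl⟩).2 (H _)

/-- The partial isomorphism whose graph is a given relation preserving equality and the symbols of
the vocabulary in both directions. -/
theorem exists_partialEquiv {M N : Model.{u}} (R : M.carrier → N.carrier → Prop)
    (heq : ∀ a b a' b', R a b → R a' b' → (a = a' ↔ b = b'))
    (hU : ∀ i a b, R a b → (M.un i a ↔ N.un i b))
    (hB : ∀ i a b a' b', R a b → R a' b' → (M.bin i a a' ↔ N.bin i b b')) :
    ∃ f : M.carrier ≃ₚ[Sig] N.carrier, (∀ a b, graph f a b ↔ R a b) ∧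
      (∀ a, a ∈ f.dom ↔ ∃ b, R a b) ∧ (∀ b, b ∈ f.cod ↔ ∃ a, R a b) := by
  classical
  let A : Sig.Substructure M.carrier := ⟨{a | ∃ b, R a b}, fun f => isEmptyElim f⟩
  let B : Sig.Substructure N.carrier := ⟨{b | ∃ a, R a b}, fun f => isEmptyElim f⟩
  have hA : ∀ a : A, ∃ b, R a b := fun a => a.2
  choose t ht using hA
  let e : A → B := fun a => ⟨t a, a, ht a⟩
  have he : Function.Bijective e := by
    constructor
    · intro a a' h
      exact Subtype.ext ((heq _ _ _ _ (ht a) (ht a')).2 (congrArg Subtype.val h))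
    · rintro ⟨b, a, hab⟩
      exact ⟨⟨a, b, hab⟩, Subtype.ext ((heq _ _ _ _ (ht ⟨a, b, hab⟩) hab).1 rfl)⟩
  let E : A ≃[Sig] B := ⟨Equiv.ofBijective e he, fun f => isEmptyElim f, by
    intro n r xs
    cases r with
    | unary i =>
      exact (relMap_unary N i _).trans
        ((hU i _ _ (ht (xs 0))).symm.trans (relMap_unary M i fun j => (xs j : M.carrier)).symm)
    | binary i =>
      exact (relMap_binary N i _).trans ((hB i _ _ _ _ (ht (xs 0)) (ht (xs 1))).symm.trans
        (relMap_binary M i fun j => (xs j : M.carrier)).symm)⟩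
  refine ⟨⟨A, B, E⟩, fun a b => ⟨?_, fun h => ?_⟩, fun a => Iff.rfl, fun b => Iff.rfl⟩
  · rintro ⟨h, rfl⟩
    exact ht ⟨a, h⟩
  · exact ⟨⟨b, h⟩, (heq _ _ _ _ (ht ⟨a, b, h⟩) h).1 rfl⟩

theorem le_of_graph {M N : Model.{u}} {f g : M.carrier ≃ₚ[Sig] N.carrier}
    (h : ∀ a b, graph f a b → graph g a b) : f ≤ g := by
  have hd : f.dom ≤ g.dom := fun a ha => (h a _ ⟨ha, rfl⟩).1
  refine ⟨hd, ?_⟩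
  ext x
  exact (h x _ ⟨x.2, rfl⟩).2

/-- A back-and-forth system given by relations instead of partial isomorphisms. -/
theorem potentiallyIsomorphic_of_relations {M N : Model.{u}} {ι : Type w} (r₀ : ι)
    (R : ι → M.carrier → N.carrier → Prop)
    (heq : ∀ f a b a' b', R f a b → R f a' b' → (a = a' ↔ b = b'))
    (hU : ∀ f i a b, R f a b → (M.un i a ↔ N.un i b))
    (hB : ∀ f i a b a' b', R f a b → R f a' b' → (M.bin i a a' ↔ N.bin i b b'))
    (forth : ∀ f a, ∃ g, (∀ x y, R f x y → R g x y) ∧ ∃ b, R g a b)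
    (back : ∀ f b, ∃ g, (∀ x y, R f x y → R g x y) ∧ ∃ a, R g a b) :
    M.PotentiallyIsomorphic N := by
  choose F hF hdom hcod using fun f => exists_partialEquiv (R f) (heq f) (hU f) (hB f)
  refine ⟨Set.range F, ⟨_, r₀, rfl⟩, ?_, ?_⟩
  · rintro _ ⟨f, rfl⟩ a
    obtain ⟨g, hg, hb⟩ := forth f a
    refine ⟨F g, ⟨g, rfl⟩, le_of_graph fun x y => ?_, (hdom g a).2 hb⟩
    rw [hF, hF]; exact hg x y
  · rintro _ ⟨f, rfl⟩ b
    obtain ⟨g, hg, hb⟩ := back f b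
    refine ⟨F g, ⟨g, rfl⟩, le_of_graph fun x y => ?_, (hcod g b).2 hb⟩
    rw [hF, hF]; exact hg x y

end Model

/-! ### First-order logic and its sublogics have both properties -/

theorem FO_invariant : FO.{u}.InvariantForPotentialIsomorphisms := by
  rintro M N ⟨F, ⟨f, hf⟩, forth, back⟩ φ
  exact Model.realize_iff_of_backAndForth forth back φ f hf _ _ fun i => i.elim0

theorem FO_hasCompactness : FO.{u}.HasCompactness := by
  intro S hS
  let T : Sig.Theory := S
  have hsat : T.IsSatisfiable := by
    refine Theory.isSatisfiable_iff_isFinitelySatisfiable.2 fun T' hT' => ?_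
    obtain ⟨M, hM⟩ := hS (T' : Set Sig.Sentence) hT' T'.finite_toSet
    have : M.carrier ⊨ (T' : Sig.Theory) := ⟨fun {φ} hφ => hM φ hφ⟩
    exact Theory.Model.isSatisfiable M.carrier
  obtain ⟨M⟩ := hsat
  -- Satisfiability provides a model in universe 0; it is lifted to `u`.
  let M' : T.ModelType := Theory.ModelType.ulift.{0, 0, 0, u} M
  exact ⟨⟨M'.Carrier⟩, fun φ hφ => Theory.realize_sentence_of_mem T hφ⟩

namespace Logic

theorem HasCompactness.of_containedIn {𝓛 : Logic.{u, v}} {𝓛' : Logic.{u, w}}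
    (h : 𝓛.ContainedIn 𝓛') (hc : 𝓛'.HasCompactness) : 𝓛.HasCompactness := by
  obtain ⟨f, hf⟩ := h
  intro S hS
  obtain ⟨M, hM⟩ := hc (f '' S) fun T hT hfin => by
    obtain ⟨T', hT', hfin', rfl⟩ := Set.exists_subset_image_finite_and.1 ⟨T, hT, hfin, rfl⟩
    obtain ⟨M, hM⟩ := hS T' hT' hfin'
    refine ⟨M, ?_⟩
    rintro _ ⟨φ, hφ, rfl⟩
    exact (hf M φ).1 (hM φ hφ)
  exact ⟨M, fun φ hφ => (hf M φ).2 (hM _ ⟨φ, hφ, rfl⟩)⟩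

theorem InvariantForPotentialIsomorphisms.of_containedIn {𝓛 : Logic.{u, v}} {𝓛' : Logic.{u, w}}
    (h : 𝓛.ContainedIn 𝓛') (hc : 𝓛'.InvariantForPotentialIsomorphisms) :
    𝓛.InvariantForPotentialIsomorphisms := by
  obtain ⟨f, hf⟩ := h
  intro M N hMN φ
  rw [hf M, hf N]
  exact hc M N hMN _

end Logic

/-! ### Three-variable formulas and definable classes -/

namespace Model

theorem un_relativise (M : Model.{u}) (P : Sig.Relations 1) (h : ∃ x, M.Holds P x) (i : ℕ)
    (x : (M.relativise P h).carrier) : (M.relativise P h).un i x ↔ M.un i x.1 :=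
  relMap_unary M i fun j => ((![x] : Fin 1 → M.definedBy P) j : M.carrier)

theorem bin_relativise (M : Model.{u}) (P : Sig.Relations 1) (h : ∃ x, M.Holds P x) (i : ℕ)
    (x y : (M.relativise P h).carrier) :
    (M.relativise P h).bin i x y ↔ M.bin i x.1 y.1 :=
  relMap_binary M i fun j => ((![x, y] : Fin 2 → M.definedBy P) j : M.carrier)

end Model

namespace VarFormula

variable {k : ℕ}

/-- Negation. -/
def neg (φ : VarFormula k) : VarFormula k := φ.imp falsum

/-- Conjunction. -/
def conj (φ ψ : VarFormula k) : VarFormula k := (φ.imp ψ.neg).neg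

/-- Biconditional. -/
def iff (φ ψ : VarFormula k) : VarFormula k := (φ.imp ψ).conj (ψ.imp φ)

/-- Existential quantification. -/
def ex (i : Fin k) (φ : VarFormula k) : VarFormula k := (φ.neg.all i).neg

/-- Atomic formula with a unary symbol. -/
def un (i : ℕ) (x : Fin k) : VarFormula k := rel (n := 1) (SigRel.unary i) ![x]

/-- Atomic formula with a binary symbol. -/
def bin (i : ℕ) (x y : Fin k) : VarFormula k := rel (n := 2) (SigRel.binary i) ![x, y]

variable (M : Model.{u}) (φ ψ : VarFormula k) (s : Fin k → M.carrier)

theorem realize_eq (i j : Fin k) : (eq i j).Realize M s ↔ s i = s j := Iff.rfl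

theorem realize_imp : (φ.imp ψ).Realize M s ↔ (φ.Realize M s → ψ.Realize M s) := Iff.rfl

theorem realize_all (i : Fin k) :
    (φ.all i).Realize M s ↔ ∀ a, φ.Realize M (Function.update s i a) := Iff.rfl

theorem realize_neg : φ.neg.Realize M s ↔ ¬ φ.Realize M s := Iff.rfl

theorem realize_conj : (φ.conj ψ).Realize M s ↔ φ.Realize M s ∧ ψ.Realize M s := by
  simp [conj, realize_neg, realize_imp]

theorem realize_iff : (φ.iff ψ).Realize M s ↔ (φ.Realize M s ↔ ψ.Realize M s) := by
  simp [iff, realize_conj, realize_imp, iff_def]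

theorem realize_ex (i : Fin k) :
    (φ.ex i).Realize M s ↔ ∃ a, φ.Realize M (Function.update s i a) := by
  simp [ex, realize_neg, realize_all]

theorem realize_un (i : ℕ) (x : Fin k) : (un i x).Realize M s ↔ M.un i (s x) :=
  M.relMap_unary i _

theorem realize_bin (i : ℕ) (x y : Fin k) : (bin i x y).Realize M s ↔ M.bin i (s x) (s y) :=
  M.relMap_binary i _

end VarFormula

theorem update_vec3_zero {X : Type*} (x y z a : X) :
    Function.update ![x, y, z] 0 a = ![a, y, z] := by
  ext i; fin_cases i <;> rfl

theorem update_vec3_one {X : Type*} (x y z a : X) :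
    Function.update ![x, y, z] 1 a = ![x, a, z] := by
  ext i; fin_cases i <;> rfl

theorem update_vec3_two {X : Type*} (x y z a : X) :
    Function.update ![x, y, z] 2 a = ![x, y, a] := by
  ext i; fin_cases i <;> rfl

namespace Logic

/-- A class of models is definable if it is the class of models of a single sentence. -/
def Definable (𝓛 : Logic.{u, v}) (K : Model.{u} → Prop) : Prop :=
  ∃ ψ, ∀ M, 𝓛.Sat M ψ ↔ K M

namespace Definable

variable {𝓛 : Logic.{u, v}} {K K' : Model.{u} → Prop}

theorem congr (h : 𝓛.Definable K) (e : ∀ M, K M ↔ K' M) : 𝓛.Definable K' :=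
  h.imp fun _ hψ M => (hψ M).trans (e M)

theorem and (habs : 𝓛.IsAbstractLogic) (h : 𝓛.Definable K) (h' : 𝓛.Definable K') :
    𝓛.Definable fun M => K M ∧ K' M := by
  obtain ⟨φ, hφ⟩ := h
  obtain ⟨ψ, hψ⟩ := h'
  obtain ⟨χ, hχ⟩ := habs.conj φ ψ
  exact ⟨χ, fun M => by rw [hχ, hφ, hψ]⟩

theorem not (habs : 𝓛.IsAbstractLogic) (h : 𝓛.Definable K) : 𝓛.Definable fun M => ¬ K M := by
  obtain ⟨φ, hφ⟩ := h
  obtain ⟨χ, hχ⟩ := habs.neg φ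
  exact ⟨χ, fun M => by rw [hχ, hφ]⟩

/-- The universal closure of a formula in three variables. -/
theorem of_varFormula (hext : (FOVar.{u} 3).ContainedIn 𝓛) (θ : VarFormula 3) :
    𝓛.Definable fun M => ∀ x y z, θ.Realize M ![x, y, z] := by
  obtain ⟨f, hf⟩ := hext
  have hfree : (((θ.all 2).all 1).all 0).freeVars = ∅ := by
    ext i
    fin_cases i <;> simp [VarFormula.freeVars]
  refine ⟨f ⟨((θ.all 2).all 1).all 0, hfree⟩, fun M => (hf M _).symm.trans ?_⟩
  · have key : ∀ (s : Fin 3 → M.carrier) (x y z : M.carrier),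
        Function.update (Function.update (Function.update s 0 x) 1 y) 2 z = ![x, y, z] := by
      intro s x y z
      ext i; fin_cases i <;> rfl
    obtain ⟨c⟩ := M.nonempty
    change (∀ s, ∀ x y z, θ.Realize M _) ↔ _
    simp only [key]
    -- Truth of a sentence quantifies over all assignments; nonemptiness of the model supplies one.
    exact ⟨fun h => h fun _ => c, fun h _ => h⟩

/-- Here `p` is a condition outside the model, such as `n < k`. When it fails, a valid sentence
serves, so one sequence of conditions can be indexed by all `n`. -/
theorem imp_const (hext : (FOVar.{u} 3).ContainedIn 𝓛) (p : Prop) (h : 𝓛.Definable K) :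
    𝓛.Definable fun M => p → K M := by
  by_cases hp : p
  · exact h.congr fun M => by simp [hp]
  · exact (of_varFormula hext (VarFormula.eq 0 0)).congr fun M => by
      simp [hp, VarFormula.realize_eq]

end Definable

/-- Compactness for a class of models together with countably many further conditions. -/
theorem HasCompactness.exists_model {𝓛 : Logic.{u, v}} (hc : 𝓛.HasCompactness)
    {K : Model.{u} → Prop} {χ : ℕ → Model.{u} → Prop} (hK : 𝓛.Definable K)
    (hχ : ∀ n, 𝓛.Definable (χ n)) (h : ∀ N, ∃ M, K M ∧ ∀ n < N, χ n M) :
    ∃ M, K M ∧ ∀ n, χ n M := by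
  obtain ⟨κ, hκ⟩ := hK
  choose ψ hψ using hχ
  obtain ⟨M, hM⟩ := hc (insert κ (Set.range ψ)) fun T hT hfin => by
    -- A finite set of conditions involves only indices below some `N`, so models of the initial
    -- segments suffice.
    have hbound : ∃ N, ∀ φ ∈ T, φ = κ ∨ ∃ n < N, ψ n = φ := by
      induction T, hfin using Set.Finite.induction_on with
      | empty => exact ⟨0, by simp⟩
      | @insert a T _ _ ih =>
        obtain ⟨N, hN⟩ := ih fun x hx => hT (Or.inr hx)
        rcases hT (Or.inl rfl) with ha | ⟨n, hn⟩
        · refine ⟨N, ?_⟩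
          rintro φ (rfl | hφ)
          · exact Or.inl ha
          · exact hN φ hφ
        · refine ⟨max N (n + 1), ?_⟩
          rintro φ (rfl | hφ)
          · exact Or.inr ⟨n, by omega, hn⟩
          · exact (hN φ hφ).imp_right fun ⟨m, hm, e⟩ => ⟨m, by omega, e⟩
    obtain ⟨N, hN⟩ := hbound
    obtain ⟨M, hKM, hM⟩ := h N
    refine ⟨M, fun φ hφ => ?_⟩
    rcases hN φ hφ with rfl | ⟨n, hn, rfl⟩
    · exact (hκ M).2 hKM
    · exact (hψ n M).2 (hM n hn)
  exact ⟨M, (hκ M).1 (hM _ (Or.inl rfl)), fun n => (hψ n M).1 (hM _ (Or.inr ⟨n, rfl⟩))⟩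

end Logic

/-! ### Dependence on finitely many symbols -/

/-- The renaming of the `i`-th symbols to the `2 * i + c`-th ones. -/
def doubling (c : ℕ) : Sig →ᴸ Sig where
  onFunction := fun {_} f => Empty.elim f
  onRelation := fun {_} R => match R with
    | SigRel.unary i => SigRel.unary (2 * i + c)
    | SigRel.binary i => SigRel.binary (2 * i + c)

namespace Model

theorem un_doubling (M : Model.{u}) (c i : ℕ) (x : M.carrier) :
    (M.rename (doubling c)).un i x ↔ M.un (2 * i + c) x := Iff.rfl

theorem bin_doubling (M : Model.{u}) (c i : ℕ) (x y : M.carrier) :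
    (M.rename (doubling c)).bin i x y ↔ M.bin (2 * i + c) x y := Iff.rfl

end Model

namespace Logic

variable {𝓛 : Logic.{u, v}}

theorem IsAbstractLogic.sat_of_equiv (habs : 𝓛.IsAbstractLogic) {M N : Model.{u}} {φ : 𝓛.Fml}
    (e : M.carrier ≃ N.carrier) (hU : ∀ i x, N.un i (e x) ↔ M.un i x)
    (hB : ∀ i x y, N.bin i (e x) (e y) ↔ M.bin i x y) (h : 𝓛.Sat M φ) : 𝓛.Sat N φ :=
  (habs.iso_invariant M N (Model.nonempty_equiv M N e hU hB) φ).1 h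

/-- In a compact logic, every sentence depends on finitely many symbols only. -/
theorem exists_dependsOn (habs : 𝓛.IsAbstractLogic) (hext : (FOVar.{u} 3).ContainedIn 𝓛)
    (hc : 𝓛.HasCompactness) (φ : 𝓛.Fml) :
    ∃ k, ∀ (M N : Model.{u}) (e : M.carrier ≃ N.carrier),
      (∀ i < k, ∀ x, N.un i (e x) ↔ M.un i x) →
      (∀ i < k, ∀ x y, N.bin i (e x) (e y) ↔ M.bin i x y) → 𝓛.Sat M φ → 𝓛.Sat N φ := by
  -- Counterexamples for each `k` are merged on one domain, with even symbols for `M` and odd ones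
  -- for `N`. Compactness makes all even symbols agree with their odd partners, while `φ` holds of
  -- the even reduct and fails of the odd one, although the two are isomorphic.
  by_contra! H
  obtain ⟨M, ⟨h₀, h₁⟩, hM⟩ := hc.exists_model
    (K := fun M => 𝓛.Sat (M.rename (doubling 0)) φ ∧ ¬ 𝓛.Sat (M.rename (doubling 1)) φ)
    (χ := fun n M => ∀ x y, (M.un (2 * n) x ↔ M.un (2 * n + 1) x) ∧
      (M.bin (2 * n) x y ↔ M.bin (2 * n + 1) x y))
    (Definable.and habs (habs.rename _ φ) (Definable.not habs (habs.rename _ φ)))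
    (fun n => (Definable.of_varFormula hext
      (((VarFormula.un (2 * n) 0).iff (VarFormula.un (2 * n + 1) 0)).conj
        ((VarFormula.bin (2 * n) 0 1).iff (VarFormula.bin (2 * n + 1) 0 1)))).congr fun M => by
          simp [VarFormula.realize_conj, VarFormula.realize_iff, VarFormula.realize_un,
            VarFormula.realize_bin])
    (fun k => by
      obtain ⟨M, N, e, hU, hB, hM, hN⟩ := H k
      let L : Model.{u} := Model.mk' M.carrier
        (fun j x => if j % 2 = 0 then M.un (j / 2) x else N.un (j / 2) (e x))
        (fun j x y => if j % 2 = 0 then M.bin (j / 2) x y else N.bin (j / 2) (e x) (e y))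
      have hu₀ : ∀ i x, L.un (2 * i) x ↔ M.un i x := fun i x =>
        (Model.un_mk' _ _ _ _ _).trans (by simp)
      have hu₁ : ∀ i x, L.un (2 * i + 1) x ↔ N.un i (e x) := fun i x =>
        (Model.un_mk' _ _ _ _ _).trans (by
          rw [if_neg (by omega), show (2 * i + 1) / 2 = i by omega])
      have hb₀ : ∀ i x y, L.bin (2 * i) x y ↔ M.bin i x y := fun i x y =>
        (Model.bin_mk' _ _ _ _ _ _).trans (by simp)
      have hb₁ : ∀ i x y, L.bin (2 * i + 1) x y ↔ N.bin i (e x) (e y) := fun i x y =>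
        (Model.bin_mk' _ _ _ _ _ _).trans (by
          rw [if_neg (by omega), show (2 * i + 1) / 2 = i by omega])
      refine ⟨L, ⟨?_, fun h => hN ?_⟩, fun n hn x y => ⟨?_, ?_⟩⟩
      · exact habs.sat_of_equiv (M := M) (N := L.rename (doubling 0)) (Equiv.refl M.carrier)
          (fun i x => (L.un_doubling 0 i x).trans (hu₀ i x))
          (fun i x y => (L.bin_doubling 0 i x y).trans (hb₀ i x y)) hM
      · exact habs.sat_of_equiv (M := L.rename (doubling 1)) (N := N) e
          (fun i x => ((L.un_doubling 1 i x).trans (hu₁ i x)).symm)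
          (fun i x y => ((L.bin_doubling 1 i x y).trans (hb₁ i x y)).symm) h
      · exact (hu₀ n x).trans ((hU n hn x).symm.trans (hu₁ n x).symm)
      · exact (hb₀ n x y).trans ((hB n hn x y).symm.trans (hb₁ n x y).symm))
  exact h₁ (habs.sat_of_equiv (M := M.rename (doubling 0)) (N := M.rename (doubling 1))
    (Equiv.refl M.carrier)
    (fun i x => (M.un_doubling 1 i x).trans ((hM i x x).1.symm.trans (M.un_doubling 0 i x).symm))
    (fun i x y =>
      (M.bin_doubling 1 i x y).trans ((hM i x y).2.symm.trans (M.bin_doubling 0 i x y).symm)) h₀)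

end Logic

/-! ### Ehrenfeucht–Fraïssé games and first-order types -/

/-- Two tuples satisfy the same atomic formulas with symbols of index below `k`. -/
def Agree (k : ℕ) (M N : Model.{u}) {m : ℕ} (a : Fin m → M.carrier) (b : Fin m → N.carrier) :
    Prop :=
  (∀ i j, a i = a j ↔ b i = b j) ∧ (∀ l < k, ∀ i, M.un l (a i) ↔ N.un l (b i)) ∧
    ∀ l < k, ∀ i j, M.bin l (a i) (a j) ↔ N.bin l (b i) (b j)

/-- Duplicator wins the Ehrenfeucht–Fraïssé game with `n` rounds for the symbols of index below `k`
from the given position. -/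
def EF (k : ℕ) (M N : Model.{u}) : ℕ → (m : ℕ) → (Fin m → M.carrier) → (Fin m → N.carrier) → Prop
  | 0, _, a, b => Agree k M N a b
  | n + 1, m, a, b => Agree k M N a b ∧
      (∀ c, ∃ d, EF k M N n (m + 1) (Fin.snoc a c) (Fin.snoc b d)) ∧
      (∀ d, ∃ c, EF k M N n (m + 1) (Fin.snoc a c) (Fin.snoc b d))

theorem EF.agree {k : ℕ} {M N : Model.{u}} {n m : ℕ} {a : Fin m → M.carrier}
    {b : Fin m → N.carrier} (h : EF k M N n m a b) : Agree k M N a b := by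
  cases n with
  | zero => exact h
  | succ n => exact h.1

theorem exists_formulas_agree (k m : ℕ) : ∃ (ι : Type) (_ : Finite ι)
    (S : ι → Sig.BoundedFormula Empty m), ∀ (M N : Model.{u}) (a : Fin m → M.carrier)
      (b : Fin m → N.carrier),
      (∀ i, (S i).Realize default a ↔ (S i).Realize default b) → Agree k M N a b := by
  refine ⟨(Fin m × Fin m) ⊕ (Fin k × Fin m) ⊕ (Fin k × Fin m × Fin m), inferInstance,
    Sum.elim (fun p => Term.bdEqual (Term.var (Sum.inr p.1)) (Term.var (Sum.inr p.2)))
      (Sum.elim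
        (fun p => Relations.boundedFormula₁ (L := Sig) (SigRel.unary p.1 : Sig.Relations 1)
          (Term.var (Sum.inr p.2)))
        (fun p => Relations.boundedFormula₂ (L := Sig) (SigRel.binary p.1 : Sig.Relations 2)
          (Term.var (Sum.inr p.2.1)) (Term.var (Sum.inr p.2.2)))), fun M N a b h => ⟨?_, ?_, ?_⟩⟩
  · intro i j
    simpa using h (Sum.inl (i, j))
  · intro l hl i
    exact BoundedFormula.realize_rel₁.symm.trans
      ((h (Sum.inr (Sum.inl (⟨l, hl⟩, i)))).trans BoundedFormula.realize_rel₁)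
  · intro l hl i j
    exact BoundedFormula.realize_rel₂.symm.trans
      ((h (Sum.inr (Sum.inr (⟨l, hl⟩, i, j)))).trans BoundedFormula.realize_rel₂)

open Classical in
/-- The formula saying that exactly the members of a family with index in `P` are true. -/
noncomputable def typeFormula {ι : Type} [Finite ι] {m : ℕ} (S : ι → Sig.BoundedFormula Empty m)
    (P : Set ι) : Sig.BoundedFormula Empty m :=
  BoundedFormula.iInf fun i => if i ∈ P then S i else (S i).not

theorem realize_typeFormula {ι : Type} [Finite ι] {m : ℕ} (S : ι → Sig.BoundedFormula Empty m)
    (P : Set ι) (M : Model.{u}) (a : Fin m → M.carrier) :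
    (typeFormula S P).Realize default a ↔ ∀ i, i ∈ P ↔ (S i).Realize default a := by
  classical
  rw [typeFormula, BoundedFormula.realize_iInf]
  refine forall_congr' fun i => ?_
  by_cases h : i ∈ P <;> simp [h]

/-- A finite family of first-order formulas controls the game with `n` rounds. -/
theorem exists_formulas_ef (k n : ℕ) : ∀ m : ℕ, ∃ (ι : Type) (_ : Finite ι)
    (S : ι → Sig.BoundedFormula Empty m), ∀ (M N : Model.{u}) (a : Fin m → M.carrier)
      (b : Fin m → N.carrier),
      (∀ i, (S i).Realize default a ↔ (S i).Realize default b) → EF k M N n m a b := by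
  induction n with
  | zero => exact exists_formulas_agree k
  | succ n ih =>
    intro m
    obtain ⟨ι₀, _, S₀, h₀⟩ := exists_formulas_agree.{u} k m
    obtain ⟨ι, _, S, hS⟩ := ih (m + 1)
    -- For each possible truth pattern `P` of the formulas for one more element, a formula says that
    -- some element realises `P`. There are finitely many patterns, and the answer to a move is any
    -- element realising the same pattern.
    refine ⟨ι₀ ⊕ Set ι, inferInstance, Sum.elim S₀ fun P => (typeFormula S P).ex,
      fun M N a b h => ⟨h₀ M N a b fun i => h (Sum.inl i), fun c => ?_, fun d => ?_⟩⟩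
    · have := h (Sum.inr {i | (S i).Realize default (Fin.snoc a c : Fin (m + 1) → M.carrier)})
      simp only [Sum.elim_inr, BoundedFormula.realize_ex, realize_typeFormula] at this
      obtain ⟨d, hd⟩ := this.1 ⟨c, fun i => Iff.rfl⟩
      exact ⟨d, hS M N _ _ hd⟩
    · have := h (Sum.inr {i | (S i).Realize default (Fin.snoc b d : Fin (m + 1) → N.carrier)})
      simp only [Sum.elim_inr, BoundedFormula.realize_ex, realize_typeFormula] at this
      obtain ⟨c, hc⟩ := this.2 ⟨d, fun i => Iff.rfl⟩
      exact ⟨c, hS M N _ _ fun i => (hc i).symm⟩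

/-- A class of models closed under `n`-round equivalence is first-order definable. -/
theorem definable_FO_of_ef (K : Model.{u} → Prop) (k n : ℕ)
    (h : ∀ M N : Model.{u}, EF k M N n 0 default default → K M → K N) : FO.{u}.Definable K := by
  obtain ⟨ι, _, S, hS⟩ := exists_formulas_ef.{u} k n 0
  let type : Model.{u} → Set ι := fun M => {i | (S i).Realize default (default : Fin 0 → M.carrier)}
  let θ : Sig.BoundedFormula Empty 0 :=
    -- The disjunction ranges over types, not models, so it is finite.
    BoundedFormula.iSup fun P : {P : Set ι // ∃ M, K M ∧ P = type M} => typeFormula S P.1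
  refine ⟨θ, fun N => ?_⟩
  have hθ : FO.{u}.Sat N θ ↔ θ.Realize default (default : Fin 0 → N.carrier) := Iff.rfl
  rw [hθ, BoundedFormula.realize_iSup]
  simp only [realize_typeFormula]
  constructor
  · rintro ⟨⟨_, M, hM, rfl⟩, hP⟩
    exact h M N (hS M N _ _ hP) hM
  · exact fun hN => ⟨⟨type N, N, hN, rfl⟩, fun i => Iff.rfl⟩

/-! ### Axioms of the coded game -/

/-- The part of the description of a game that does not involve the levels of the positions and
the symbols that the game is about. The unary symbols `k` and `k + 1` define the two boards, and
`k + 2` the initial positions; the positions with `n` rounds left are defined by `k + 3 + n`. The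
binary symbols `k` and `k + 1` are the projections from pairs to the boards, `k + 2` is the
membership of pairs in positions, and `k + 3` holds between a position and its successors. -/
structure IsGame (k : ℕ) (M : Model.{u}) : Prop where
  fst_unique : ∀ p x y, M.bin k p x → M.bin k p y → x = y
  snd_unique : ∀ p x y, M.bin (k + 1) p x → M.bin (k + 1) p y → x = y
  -- The existential form lets `x` reuse the variable of `f`, which is no longer needed.
  eq_iff : ∀ f p q, M.bin (k + 2) p f → M.bin (k + 2) q f →
    ((∃ x, M.bin k p x ∧ M.bin k q x) ↔ ∃ x, M.bin (k + 1) p x ∧ M.bin (k + 1) q x)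
  mono : ∀ f g p, M.bin (k + 3) f g → M.bin (k + 2) p f → M.bin (k + 2) p g
  -- When `p` is introduced `f` is no longer needed, and when `b` is introduced neither is `g`;
  -- their variables are requantified. A move is demanded of everything outside level 0, including
  -- elements of no finite level.
  forth : ∀ f a, ¬ M.un (k + 3) f → M.un k a → ∃ g, M.bin (k + 3) f g ∧ ∃ p,
    M.bin (k + 2) p g ∧ M.bin k p a ∧ ∃ b, M.bin (k + 1) p b ∧ M.un (k + 1) b
  back : ∀ f b, ¬ M.un (k + 3) f → M.un (k + 1) b → ∃ g, M.bin (k + 3) f g ∧ ∃ p,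
    M.bin (k + 2) p g ∧ M.bin (k + 1) p b ∧ ∃ a, M.bin k p a ∧ M.un k a
  initial : ∃ f, M.un (k + 2) f
  left : ∃ x, M.un k x
  right : ∃ x, M.un (k + 1) x

/-- The conditions on positions that involve the `n`-th symbols or positions with `n` rounds left. -/
structure IsGameAt (k n : ℕ) (M : Model.{u}) : Prop where
  un_iff : n < k → ∀ f p, M.bin (k + 2) p f →
    ((∃ x, M.bin k p x ∧ M.un n x) ↔ ∃ x, M.bin (k + 1) p x ∧ M.un n x)
  bin_iff : n < k → ∀ f p q, M.bin (k + 2) p f → M.bin (k + 2) q f →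
    ((∃ x, M.bin k p x ∧ ∃ y, M.bin k q y ∧ M.bin n x y) ↔
      ∃ x, M.bin (k + 1) p x ∧ ∃ y, M.bin (k + 1) q y ∧ M.bin n x y)
  -- Read contrapositively for all `n`: a successor of an element of no finite level has no finite
  -- level.
  level : ∀ f g, M.bin (k + 3) f g → M.un (k + 3 + n) g → M.un (k + 3 + (n + 1)) f
  initial : ∀ f, M.un (k + 2) f → ¬ M.un (k + 3 + n) f

namespace Logic

open VarFormula

variable {𝓛 : Logic.{u, v}}

/-- Each clause is a formula in three variables; the conjunction is taken in `𝓛`. -/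
theorem definable_isGame (habs : 𝓛.IsAbstractLogic) (hext : (FOVar.{u} 3).ContainedIn 𝓛) (k : ℕ) :
    𝓛.Definable (IsGame k) := by
  have d := Definable.of_varFormula hext
  have h := (d (.imp (bin k 0 1) (.imp (bin k 0 2) (.eq 1 2)))).and habs <|
    (d (.imp (bin (k + 1) 0 1) (.imp (bin (k + 1) 0 2) (.eq 1 2)))).and habs <|
    (d (.imp (bin (k + 2) 1 0) (.imp (bin (k + 2) 2 0)
      (.iff (.ex 0 (.conj (bin k 1 0) (bin k 2 0)))
        (.ex 0 (.conj (bin (k + 1) 1 0) (bin (k + 1) 2 0))))))).and habs <|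
    (d (.imp (bin (k + 3) 0 1) (.imp (bin (k + 2) 2 0) (bin (k + 2) 2 1)))).and habs <|
    (d (.imp (.neg (un (k + 3) 0)) (.imp (un k 1) (.ex 2 (.conj (bin (k + 3) 0 2)
      (.ex 0 (.conj (bin (k + 2) 0 2) (.conj (bin k 0 1)
        (.ex 2 (.conj (bin (k + 1) 0 2) (un (k + 1) 2))))))))))).and habs <|
    (d (.imp (.neg (un (k + 3) 0)) (.imp (un (k + 1) 1) (.ex 2 (.conj (bin (k + 3) 0 2)
      (.ex 0 (.conj (bin (k + 2) 0 2) (.conj (bin (k + 1) 0 1)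
        (.ex 2 (.conj (bin k 0 2) (un k 2))))))))))).and habs <|
    (d (.ex 0 (un (k + 2) 0))).and habs <| (d (.ex 0 (un k 0))).and habs <| d (.ex 0 (un (k + 1) 0))
  refine h.congr fun M => ?_
  simp only [realize_imp, realize_iff, realize_conj, realize_ex, realize_neg, realize_eq,
    realize_un, realize_bin, update_vec3_zero, update_vec3_two, Matrix.cons_val, forall_const]
  exact ⟨fun ⟨h₁, h₂, h₃, h₄, h₅, h₆, h₇, h₈, h₉⟩ => ⟨h₁, h₂, h₃, h₄, h₅, h₆, h₇, h₈, h₉⟩,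
    fun ⟨h₁, h₂, h₃, h₄, h₅, h₆, h₇, h₈, h₉⟩ => ⟨h₁, h₂, h₃, h₄, h₅, h₆, h₇, h₈, h₉⟩⟩

theorem definable_isGameAt (habs : 𝓛.IsAbstractLogic) (hext : (FOVar.{u} 3).ContainedIn 𝓛)
    (k n : ℕ) : 𝓛.Definable (IsGameAt k n) := by
  have d := Definable.of_varFormula hext
  have h := ((d (.imp (bin (k + 2) 1 0)
      (.iff (.ex 0 (.conj (bin k 1 0) (un n 0)))
        (.ex 0 (.conj (bin (k + 1) 1 0) (un n 0)))))).imp_const hext (n < k)).and habs <|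
    ((d (.imp (bin (k + 2) 1 0) (.imp (bin (k + 2) 2 0)
      (.iff (.ex 0 (.conj (bin k 1 0) (.ex 1 (.conj (bin k 2 1) (bin n 0 1)))))
        (.ex 0 (.conj (bin (k + 1) 1 0)
          (.ex 1 (.conj (bin (k + 1) 2 1) (bin n 0 1))))))))).imp_const hext (n < k)).and habs <|
    (d (.imp (bin (k + 3) 0 1) (.imp (un (k + 3 + n) 1) (un (k + 3 + (n + 1)) 0)))).and habs <|
    d (.imp (un (k + 2) 0) (.neg (un (k + 3 + n) 0)))
  refine h.congr fun M => ?_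
  simp only [realize_imp, realize_iff, realize_conj, realize_ex, realize_neg,
    realize_un, realize_bin, update_vec3_zero, update_vec3_one, Matrix.cons_val, forall_const]
  exact ⟨fun ⟨h₁, h₂, h₃, h₄⟩ => ⟨h₁, h₂, h₃, h₄⟩, fun ⟨h₁, h₂, h₃, h₄⟩ => ⟨h₁, h₂, h₃, h₄⟩⟩

end Logic

/-- The model in which all symbols of index at least `k` are interpreted by the empty relation. -/
def Model.truncate (M : Model.{u}) (k : ℕ) : Model.{u} :=
  Model.mk' M.carrier (fun i x => i < k ∧ M.un i x) (fun i x y => i < k ∧ M.bin i x y)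

/-- A game without a bound on the number of rounds yields a potential isomorphism between the two
boards. -/
theorem IsGame.potentiallyIsomorphic {k : ℕ} {M : Model.{u}} (hM : IsGame k M)
    (hn : ∀ n, IsGameAt k n M) (hA : ∃ x, M.Holds (SigRel.unary k) x)
    (hB : ∃ x, M.Holds (SigRel.unary (k + 1)) x) :
    ((M.relativise _ hA).truncate k).PotentiallyIsomorphic ((M.relativise _ hB).truncate k) := by
  obtain ⟨f₀, hf₀⟩ := hM.initial
  refine Model.potentiallyIsomorphic_of_relations
    (M := (M.relativise _ hA).truncate k) (N := (M.relativise _ hB).truncate k)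
    -- The indices are the elements of no finite level, which `forth` and `back` never lead out of.
    -- The relation of `f` consists of the projections of the pairs belonging to `f`.
    (ι := {f // ∀ n, ¬ M.un (k + 3 + n) f}) ⟨f₀, fun n => (hn n).initial f₀ hf₀⟩
    (fun f (a : M.definedBy _) (b : M.definedBy _) =>
      ∃ p, M.bin (k + 2) p f.1 ∧ M.bin k p a.1 ∧ M.bin (k + 1) p b.1) ?_ ?_ ?_ ?_ ?_
  · rintro ⟨f, hf⟩ ⟨a, ha⟩ ⟨b, hb⟩ ⟨a', ha'⟩ ⟨b', hb'⟩ ⟨p, hp, hpa, hpb⟩ ⟨q, hq, hqa, hqb⟩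
    have h := hM.eq_iff f p q hp hq
    constructor
    · intro e
      obtain rfl : a = a' := congrArg Subtype.val e
      obtain ⟨y, hy, hy'⟩ := h.1 ⟨a, hpa, hqa⟩
      exact Subtype.ext ((hM.snd_unique p _ _ hpb hy).trans (hM.snd_unique q _ _ hy' hqb))
    · intro e
      obtain rfl : b = b' := congrArg Subtype.val e
      obtain ⟨y, hy, hy'⟩ := h.2 ⟨b, hpb, hqb⟩
      exact Subtype.ext ((hM.fst_unique p _ _ hpa hy).trans (hM.fst_unique q _ _ hy' hqa))
  · rintro ⟨f, hf⟩ i ⟨a, ha⟩ ⟨b, hb⟩ ⟨p, hp, hpa, hpb⟩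
    -- After truncation only symbols with `i < k` have to be compared.
    refine and_congr_right fun hi => ?_
    refine (Model.un_relativise M _ hA i _).trans (Iff.trans ?_ (Model.un_relativise M _ hB i _).symm)
    have h := (hn i).un_iff hi f p hp
    constructor
    · intro e
      obtain ⟨y, hy, hy'⟩ := h.1 ⟨a, hpa, e⟩
      exact hM.snd_unique p _ _ hy hpb ▸ hy'
    · intro e
      obtain ⟨y, hy, hy'⟩ := h.2 ⟨b, hpb, e⟩
      exact hM.fst_unique p _ _ hy hpa ▸ hy'
  · rintro ⟨f, hf⟩ i ⟨a, ha⟩ ⟨b, hb⟩ ⟨a', ha'⟩ ⟨b', hb'⟩ ⟨p, hp, hpa, hpb⟩ ⟨q, hq, hqa, hqb⟩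
    refine and_congr_right fun hi => ?_
    refine (Model.bin_relativise M _ hA i _ _).trans
      (Iff.trans ?_ (Model.bin_relativise M _ hB i _ _).symm)
    have h := (hn i).bin_iff hi f p q hp hq
    constructor
    · intro e
      obtain ⟨y, hy, z, hz, hyz⟩ := h.1 ⟨a, hpa, a', hqa, e⟩
      exact hM.snd_unique p _ _ hy hpb ▸ hM.snd_unique q _ _ hz hqb ▸ hyz
    · intro e
      obtain ⟨y, hy, z, hz, hyz⟩ := h.2 ⟨b, hpb, b', hqb, e⟩
      exact hM.fst_unique p _ _ hy hpa ▸ hM.fst_unique q _ _ hz hqa ▸ hyz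
  · rintro ⟨f, hf⟩ ⟨a, ha⟩
    obtain ⟨g, hfg, p, hp, hpa, b, hpb, hb⟩ := hM.forth f a (hf 0) ha
    refine ⟨⟨g, fun n hg => hf (n + 1) ((hn n).level f g hfg hg)⟩, ?_, ⟨b, hb⟩, p, hp, hpa, hpb⟩
    rintro x y ⟨q, hq, h⟩
    exact ⟨q, hM.mono f g q hfg hq, h⟩
  · rintro ⟨f, hf⟩ ⟨b, hb⟩
    obtain ⟨g, hfg, p, hp, hpb, a, hpa, ha⟩ := hM.back f b (hf 0) hb
    refine ⟨⟨g, fun n hg => hf (n + 1) ((hn n).level f g hfg hg)⟩, ?_, ⟨a, ha⟩, p, hp, hpa, hpb⟩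
    rintro x y ⟨q, hq, h⟩
    exact ⟨q, hM.mono f g q hfg hq, h⟩

/-! ### The model coding a finite game -/

/-- The domain of the model describing the Ehrenfeucht–Fraïssé game. -/
inductive GameCarrier (k : ℕ) (M N : Model.{u}) : Type u
  | left (a : M.carrier) : GameCarrier k M N
  | right (b : N.carrier) : GameCarrier k M N
  | pair (a : M.carrier) (b : N.carrier) : GameCarrier k M N
  | pos (l m : ℕ) (s : Fin m → M.carrier) (t : Fin m → N.carrier) (h : EF k M N l m s t) :
      GameCarrier k M N

namespace GameCarrier

variable {k : ℕ} {M N : Model.{u}}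

instance : Nonempty (GameCarrier k M N) := M.nonempty.map left

/-- The unary relations of the game with `n` rounds. -/
def un (n i : ℕ) : GameCarrier k M N → Prop
  -- Elements that are not positions are put in level 0, which exempts them from `forth` and `back`.
  | left a => (i < k ∧ M.un i a) ∨ i = k ∨ i = k + 3
  | right b => (i < k ∧ N.un i b) ∨ i = k + 1 ∨ i = k + 3
  | pair _ _ => i = k + 3
  | pos l _ _ _ _ => i = k + 3 + l ∨ (i = k + 2 ∧ l = n)

/-- The binary relations of the game. -/
def bin (i : ℕ) : GameCarrier k M N → GameCarrier k M N → Prop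
  | left a, left a' => i < k ∧ M.bin i a a'
  | right b, right b' => i < k ∧ N.bin i b b'
  | pair a _, left a' => i = k ∧ a = a'
  | pair _ b, right b' => i = k + 1 ∧ b = b'
  | pair a b, pos _ _ s t _ => i = k + 2 ∧ ∃ j, s j = a ∧ t j = b
  -- A successor has one round fewer and contains the old pairs; it may contain any number of new
  -- ones.
  | pos l _ s t _, pos l' _ s' t' _ =>
      i = k + 3 ∧ l = l' + 1 ∧ ∀ j, ∃ j', s' j' = s j ∧ t' j' = t j
  | _, _ => False

variable (k M N) in
/-- The model describing the game with `n` rounds. -/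
def model (n : ℕ) : Model.{u} := Model.mk' (GameCarrier k M N) (un n) bin

variable {n : ℕ}

theorem un_left {x : GameCarrier k M N} : (model k M N n).un k x ↔ ∃ a, x = left a := by
  refine (Model.un_mk' _ _ _ _ _).trans ?_
  cases x <;> (simp [un]; try omega)

theorem un_right {x : GameCarrier k M N} : (model k M N n).un (k + 1) x ↔ ∃ b, x = right b := by
  refine (Model.un_mk' _ _ _ _ _).trans ?_
  cases x <;> (simp [un]; try omega)

theorem un_initial {x : GameCarrier k M N} :
    (model k M N n).un (k + 2) x ↔ ∃ m s t h, x = pos n m s t h := by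
  refine (Model.un_mk' _ _ _ _ _).trans ?_
  cases x with
  | pos l m s t h =>
    simp only [un, pos.injEq]
    constructor
    · rintro (h' | ⟨-, rfl⟩)
      · omega
      · exact ⟨m, s, t, h, rfl, rfl, HEq.rfl, HEq.rfl⟩
    · rintro ⟨_, _, _, _, rfl, -⟩
      exact Or.inr ⟨trivial, rfl⟩
  | _ => simp [un]; try omega

theorem un_level_pos {i l m : ℕ} {s : Fin m → M.carrier} {t : Fin m → N.carrier}
    {h : EF k M N l m s t} : (model k M N n).un (k + 3 + i) (pos l m s t h) ↔ i = l := by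
  refine (Model.un_mk' _ _ _ _ _).trans ?_
  simp only [un]
  omega

theorem exists_pos_of_not_un {x : GameCarrier k M N} (hx : ¬ (model k M N n).un (k + 3) x) :
    ∃ l m s t h, x = pos (l + 1) m s t h := by
  cases x with
  | pos l m s t h =>
    cases l with
    | zero => exact (hx (Or.inl rfl)).elim
    | succ l => exact ⟨l, m, s, t, h, rfl⟩
  | left => exact (hx (Or.inr (Or.inr rfl))).elim
  | right => exact (hx (Or.inr (Or.inr rfl))).elim
  | pair => exact (hx rfl).elim

theorem bin_fst {x y : GameCarrier k M N} :
    (model k M N n).bin k x y ↔ ∃ a b, x = pair a b ∧ y = left a := by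
  refine (Model.bin_mk' _ _ _ _ _ _).trans ?_
  cases x <;> cases y <;> simp [bin, eq_comm]

theorem bin_snd {x y : GameCarrier k M N} :
    (model k M N n).bin (k + 1) x y ↔ ∃ a b, x = pair a b ∧ y = right b := by
  refine (Model.bin_mk' _ _ _ _ _ _).trans ?_
  cases x <;> cases y <;> simp [bin, eq_comm]

theorem bin_mem {x y : GameCarrier k M N} : (model k M N n).bin (k + 2) x y ↔
    ∃ l m s t h j, x = pair (s j) (t j) ∧ y = pos l m s t h := by
  refine (Model.bin_mk' _ _ _ _ _ _).trans ?_
  constructor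
  · intro h
    cases x <;> cases y <;> simp [bin] at h
    obtain ⟨j, rfl, rfl⟩ := h
    exact ⟨_, _, _, _, _, j, rfl, rfl⟩
  · rintro ⟨l, m, s, t, h, j, rfl, rfl⟩
    exact ⟨rfl, j, rfl, rfl⟩

theorem bin_succ {x y : GameCarrier k M N} : (model k M N n).bin (k + 3) x y ↔
    ∃ l m s t h m' s' t' h', x = pos (l + 1) m s t h ∧ y = pos l m' s' t' h' ∧
      ∀ j, ∃ j', s' j' = s j ∧ t' j' = t j := by
  refine (Model.bin_mk' _ _ _ _ _ _).trans ?_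
  constructor
  · intro h
    cases x <;> cases y <;> simp [bin] at h
    obtain ⟨rfl, h⟩ := h
    exact ⟨_, _, _, _, _, _, _, _, _, rfl, rfl, h⟩
  · rintro ⟨l, m, s, t, h, m', s', t', h', rfl, rfl, H⟩
    exact ⟨rfl, rfl, H⟩

theorem un_left_lt {i : ℕ} (hi : i < k) {a : M.carrier} :
    (model k M N n).un i (left a : GameCarrier k M N) ↔ M.un i a := by
  refine (Model.un_mk' _ _ _ _ _).trans ?_
  simp only [un, hi, true_and]
  exact or_iff_left (by omega)

theorem un_right_lt {i : ℕ} (hi : i < k) {b : N.carrier} :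
    (model k M N n).un i (right b : GameCarrier k M N) ↔ N.un i b := by
  refine (Model.un_mk' _ _ _ _ _).trans ?_
  simp only [un, hi, true_and]
  exact or_iff_left (by omega)

theorem bin_left_lt {i : ℕ} (hi : i < k) {a a' : M.carrier} :
    (model k M N n).bin i (left a : GameCarrier k M N) (left a' : GameCarrier k M N) ↔
      M.bin i a a' :=
  and_iff_right hi

theorem bin_right_lt {i : ℕ} (hi : i < k) {b b' : N.carrier} :
    (model k M N n).bin i (right b : GameCarrier k M N) (right b' : GameCarrier k M N) ↔
      N.bin i b b' :=
  and_iff_right hi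

/-- A pair has a unique projection, so the existential clauses of the axioms reduce to statements
about components. -/
theorem exists_fst {a : M.carrier} {b : N.carrier} {p : GameCarrier k M N → Prop} :
    (∃ x, (model k M N n).bin k (pair a b : GameCarrier k M N) x ∧ p x) ↔ p (left a) := by
  constructor
  · rintro ⟨x, h, hx⟩
    obtain ⟨_, _, e, rfl⟩ := bin_fst.1 h
    cases e
    exact hx
  · exact fun h => ⟨left a, bin_fst.2 ⟨a, b, rfl, rfl⟩, h⟩

theorem exists_snd {a : M.carrier} {b : N.carrier} {p : GameCarrier k M N → Prop} :
    (∃ x, (model k M N n).bin (k + 1) (pair a b : GameCarrier k M N) x ∧ p x) ↔ p (right b) := by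
  constructor
  · rintro ⟨x, h, hx⟩
    obtain ⟨_, _, e, rfl⟩ := bin_snd.1 h
    cases e
    exact hx
  · exact fun h => ⟨right b, bin_snd.2 ⟨a, b, rfl, rfl⟩, h⟩

theorem exists_succ_snoc {l m : ℕ} {s : Fin m → M.carrier} {t : Fin m → N.carrier}
    {h : EF k M N (l + 1) m s t} {a : M.carrier} {b : N.carrier}
    (h' : EF k M N l (m + 1) (Fin.snoc s a) (Fin.snoc t b)) :
    ∃ g : GameCarrier k M N, (model k M N n).bin (k + 3) (pos (l + 1) m s t h : GameCarrier k M N) g ∧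
      (model k M N n).bin (k + 2) (pair a b : GameCarrier k M N) g := by
  refine ⟨pos l _ _ _ h', bin_succ.2 ⟨l, _, _, _, _, _, _, _, _, rfl, rfl, fun j => ?_⟩,
    bin_mem.2 ⟨l, _, _, _, h', Fin.last m, ?_, rfl⟩⟩
  · exact ⟨j.castSucc, by simp, by simp⟩
  · simp

theorem isGame (h₀ : EF k M N n 0 default default) : IsGame k (model k M N n) where
  fst_unique p x y hx hy := by
    obtain ⟨a, b, rfl, rfl⟩ := bin_fst.1 hx
    obtain ⟨a', b', e, rfl⟩ := bin_fst.1 hy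
    cases e
    rfl
  snd_unique p x y hx hy := by
    obtain ⟨a, b, rfl, rfl⟩ := bin_snd.1 hx
    obtain ⟨a', b', e, rfl⟩ := bin_snd.1 hy
    cases e
    rfl
  eq_iff f p q hp hq := by
    obtain ⟨l, m, s, t, h, i, rfl, rfl⟩ := bin_mem.1 hp
    obtain ⟨l', m', s', t', h', j, rfl, e⟩ := bin_mem.1 hq
    cases e
    refine exists_fst.trans (Iff.trans ?_ exists_snd.symm)
    rw [bin_fst, bin_snd]
    have := h.agree.1 i j
    simp only [pair.injEq, left.injEq, right.injEq]
    constructor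
    · rintro ⟨_, _, ⟨rfl, rfl⟩, e⟩
      exact ⟨_, _, ⟨rfl, rfl⟩, this.1 e⟩
    · rintro ⟨_, _, ⟨rfl, rfl⟩, e⟩
      exact ⟨_, _, ⟨rfl, rfl⟩, this.2 e⟩
  mono f g p hfg hp := by
    obtain ⟨l, m, s, t, h, m', s', t', h', rfl, rfl, H⟩ := bin_succ.1 hfg
    obtain ⟨_, _, _, _, _, j, rfl, e⟩ := bin_mem.1 hp
    cases e
    obtain ⟨j', e₁, e₂⟩ := H j
    exact bin_mem.2 ⟨_, _, _, _, _, j', by rw [e₁, e₂], rfl⟩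
  forth f a hf ha := by
    obtain ⟨l, m, s, t, h, rfl⟩ := exists_pos_of_not_un hf
    obtain ⟨a, rfl⟩ := un_left.1 ha
    obtain ⟨b, hb⟩ := h.2.1 a
    obtain ⟨g, hg, hp⟩ := exists_succ_snoc (n := n) (h := h) hb
    exact ⟨g, hg, pair a b, hp, bin_fst.2 ⟨a, b, rfl, rfl⟩, right b, bin_snd.2 ⟨a, b, rfl, rfl⟩,
      un_right.2 ⟨b, rfl⟩⟩
  back f b hf hb := by
    obtain ⟨l, m, s, t, h, rfl⟩ := exists_pos_of_not_un hf
    obtain ⟨b, rfl⟩ := un_right.1 hb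
    obtain ⟨a, ha⟩ := h.2.2 b
    obtain ⟨g, hg, hp⟩ := exists_succ_snoc (n := n) (h := h) ha
    exact ⟨g, hg, pair a b, hp, bin_snd.2 ⟨a, b, rfl, rfl⟩, left a, bin_fst.2 ⟨a, b, rfl, rfl⟩,
      un_left.2 ⟨a, rfl⟩⟩
  initial := ⟨pos n 0 default default h₀, un_initial.2 ⟨_, _, _, h₀, rfl⟩⟩
  left := M.nonempty.elim fun a => ⟨left a, un_left.2 ⟨a, rfl⟩⟩
  right := N.nonempty.elim fun b => ⟨right b, un_right.2 ⟨b, rfl⟩⟩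

/-- The bound on `i` matters only for `initial`: initial positions have level `n`, hence no level
below `n`. -/
theorem isGameAt {i : ℕ} (hi : i < n) : IsGameAt k i (model k M N n) where
  un_iff hik f p hp := by
    obtain ⟨l, m, s, t, h, j, rfl, rfl⟩ := bin_mem.1 hp
    refine exists_fst.trans (Iff.trans ?_ exists_snd.symm)
    exact (un_left_lt hik).trans ((h.agree.2.1 i hik j).trans (un_right_lt hik).symm)
  bin_iff hik f p q hp hq := by
    obtain ⟨l, m, s, t, h, j, rfl, rfl⟩ := bin_mem.1 hp
    obtain ⟨l', m', s', t', h', j', rfl, e⟩ := bin_mem.1 hq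
    cases e
    refine exists_fst.trans (exists_fst.trans (Iff.trans ?_ (exists_snd.trans exists_snd).symm))
    exact (bin_left_lt hik).trans ((h.agree.2.2 i hik j j').trans (bin_right_lt hik).symm)
  level f g hfg hg := by
    obtain ⟨l, m, s, t, h, m', s', t', h', rfl, rfl, H⟩ := bin_succ.1 hfg
    exact un_level_pos.2 (congrArg (· + 1) (un_level_pos.1 hg))
  initial f hf hf' := by
    obtain ⟨m, s, t, h, rfl⟩ := un_initial.1 hf
    exact hi.ne (un_level_pos.1 hf')

/-- The elements of a board of the game form a copy of one of the two models. -/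
theorem exists_equiv_left (n : ℕ) (hA : ∃ x, (model k M N n).Holds (SigRel.unary k) x) :
    ∃ e : M.carrier ≃ ((model k M N n).relativise _ hA).carrier,
      (∀ i < k, ∀ x, ((model k M N n).relativise _ hA).un i (e x) ↔ M.un i x) ∧
      ∀ i < k, ∀ x y, ((model k M N n).relativise _ hA).bin i (e x) (e y) ↔ M.bin i x y := by
  have hmem : ∀ x : GameCarrier k M N,
      x ∈ (model k M N n).definedBy (SigRel.unary k) ↔ ∃ a, x = left a :=
    fun x => un_left (k := k) (M := M) (N := N) (n := n) (x := x)
  let f : M.carrier → ((model k M N n).relativise _ hA).carrier :=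
    fun a => ⟨(left a : GameCarrier k M N), (hmem _).2 ⟨a, rfl⟩⟩
  have hf : Function.Bijective f := by
    constructor
    · intro a a' h
      exact left.inj (congrArg Subtype.val h)
    · rintro ⟨x, hx⟩
      obtain ⟨a, rfl⟩ := (hmem x).1 hx
      exact ⟨a, rfl⟩
  exact ⟨Equiv.ofBijective f hf,
    fun i hi x => (Model.un_relativise _ _ hA i (f x)).trans (un_left_lt hi),
    fun i hi x y => (Model.bin_relativise _ _ hA i (f x) (f y)).trans (bin_left_lt hi)⟩

theorem exists_equiv_right (n : ℕ) (hB : ∃ x, (model k M N n).Holds (SigRel.unary (k + 1)) x) :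
    ∃ e : N.carrier ≃ ((model k M N n).relativise _ hB).carrier,
      (∀ i < k, ∀ x, ((model k M N n).relativise _ hB).un i (e x) ↔ N.un i x) ∧
      ∀ i < k, ∀ x y, ((model k M N n).relativise _ hB).bin i (e x) (e y) ↔ N.bin i x y := by
  have hmem : ∀ x : GameCarrier k M N,
      x ∈ (model k M N n).definedBy (SigRel.unary (k + 1)) ↔ ∃ a, x = right a :=
    fun x => un_right (k := k) (M := M) (N := N) (n := n) (x := x)
  let f : N.carrier → ((model k M N n).relativise _ hB).carrier :=
    fun a => ⟨(right a : GameCarrier k M N), (hmem _).2 ⟨a, rfl⟩⟩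
  have hf : Function.Bijective f := by
    constructor
    · intro a a' h
      exact right.inj (congrArg Subtype.val h)
    · rintro ⟨x, hx⟩
      obtain ⟨a, rfl⟩ := (hmem x).1 hx
      exact ⟨a, rfl⟩
  exact ⟨Equiv.ofBijective f hf,
    fun i hi x => (Model.un_relativise _ _ hB i (f x)).trans (un_right_lt hi),
    fun i hi x y => (Model.bin_relativise _ _ hB i (f x) (f y)).trans (bin_right_lt hi)⟩

end GameCarrier

/-! ### Conclusion -/

namespace Logic

variable {𝓛 : Logic.{u, v}}

/-- Every sentence of a compact logic that is invariant for potential isomorphisms is first-order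
definable. -/
theorem definable_FO (habs : 𝓛.IsAbstractLogic) (hext : (FOVar.{u} 3).ContainedIn 𝓛)
    (hc : 𝓛.HasCompactness) (hp : 𝓛.InvariantForPotentialIsomorphisms) (φ : 𝓛.Fml) :
    FO.{u}.Definable fun M => 𝓛.Sat M φ := by
  obtain ⟨k, hk⟩ := exists_dependsOn habs hext hc φ
  by_contra hdef
  have hgame : ∀ n, ∃ M N : Model.{u}, EF k M N n 0 default default ∧ 𝓛.Sat M φ ∧ ¬ 𝓛.Sat N φ := by
    intro n
    by_contra! H
    exact hdef (definable_FO_of_ef _ k n H)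
  -- These sentences speak about the boards only when the boards are nonempty, which `IsGame`
  -- ensures by `left` and `right`.
  obtain ⟨ψ₁, hψ₁⟩ := habs.relativise (SigRel.unary k) φ
  obtain ⟨ψ₂, hψ₂⟩ := habs.relativise (SigRel.unary (k + 1)) φ
  obtain ⟨M, ⟨hM, h₁, h₂⟩, hn⟩ := hc.exists_model
    (K := fun M => IsGame k M ∧ 𝓛.Sat M ψ₁ ∧ ¬ 𝓛.Sat M ψ₂) (χ := fun n => IsGameAt k n)
    ((definable_isGame habs hext k).and habs
      (.and habs ⟨ψ₁, fun _ => Iff.rfl⟩ (.not habs ⟨ψ₂, fun _ => Iff.rfl⟩)))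
    (definable_isGameAt habs hext k) (fun n => by
      obtain ⟨M, N, hEF, hM, hN⟩ := hgame n
      have hG := GameCarrier.isGame hEF
      refine ⟨GameCarrier.model k M N n, ⟨hG, ?_, fun h => hN ?_⟩,
        fun i hi => GameCarrier.isGameAt hi⟩
      · obtain ⟨e, hU, hB⟩ := GameCarrier.exists_equiv_left (M := M) (N := N) n hG.left
        exact (hψ₁ _ hG.left).2 (hk _ _ e hU hB hM)
      · obtain ⟨e, hU, hB⟩ := GameCarrier.exists_equiv_right (M := M) (N := N) n hG.right
        refine hk _ _ e.symm (fun i hi x => ?_) (fun i hi x y => ?_) ((hψ₂ _ hG.right).1 h)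
        · exact (hU i hi (e.symm x)).symm.trans
            (iff_of_eq (congrArg (Model.un _ i) (e.apply_symm_apply x)))
        · exact (hB i hi (e.symm x) (e.symm y)).symm.trans
            (iff_of_eq (congrArg₂ (Model.bin _ i) (e.apply_symm_apply x) (e.apply_symm_apply y))))
  -- The game controls only symbols of index below `k`. Since `φ` ignores the others, emptying them
  -- is harmless and makes the boards potentially isomorphic.
  have htrunc : ∀ A : Model.{u}, 𝓛.Sat A φ ↔ 𝓛.Sat (A.truncate k) φ := fun A =>
    ⟨hk A (A.truncate k) (Equiv.refl _) (fun i hi x => and_iff_right hi)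
      (fun i hi x y => and_iff_right hi),
    hk (A.truncate k) A (Equiv.refl _) (fun i hi x => (and_iff_right hi).symm)
      (fun i hi x y => (and_iff_right hi).symm)⟩
  have hpot := hM.potentiallyIsomorphic hn hM.left hM.right
  refine h₂ ((hψ₂ M hM.right).2 ((htrunc _).2 ((hp _ _ hpot φ).1 ((htrunc _).1 ?_))))
  exact (hψ₁ M hM.left).1 h₁

end Logic

end Lindstrom

theorem mainTheorem2 (𝓛 : Lindstrom.Logic.{u, v}) (habs : 𝓛.IsAbstractLogic)
    (hext : (Lindstrom.FOVar.{u} 3).ContainedIn 𝓛) :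
    𝓛.ContainedIn Lindstrom.FO.{u} ↔
      𝓛.HasCompactness ∧ 𝓛.InvariantForPotentialIsomorphisms := by
  refine ⟨fun h => ⟨.of_containedIn h Lindstrom.FO_hasCompactness,
    .of_containedIn h Lindstrom.FO_invariant⟩, fun ⟨hc, hp⟩ => ?_⟩
  choose f hf using Lindstrom.Logic.definable_FO habs hext hc hp
  exact ⟨f, fun M φ => (hf φ M).symm⟩
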